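/- Let $X \subset \mathbb{R}^n$ be closed, convex and nonempty, let $\mathcal{A} \subset \mathbb{R}^n$ be finite and nonempty, and let $\sigma_X(z) = \sup\{z^T x : x \in X\} \in (-\infty,\infty]$ be the support function of $X$. For $\nu \in \mathbb{R}^{\mathcal{A}}$ write $\mathcal{A}\nu = \sum_{\alpha\in\mathcal{A}} \nu_\alpha\,\alpha$. We use the following definitions. - Identify a signomial $\sum_{\alpha\in\mathcal{A}} c_\alpha \exp(\alpha^T x)$ with its coefficient vector $c \in \mathbb{R}^{\mathcal{A}}$. For $\beta\in\mathcal{A}$ let $C_X(\mathcal{A},\beta)$ be the set of those $c$ with $c_\alpha \ge 0$ for all $\alpha \ne \beta$ whose signomial is nonnegative on $X$. The SAGE cone is the Minkowski sum $C_X(\mathcal{A}) = \sum_{\beta\in\mathcal{A}} C_X(\mathcal{A},\beta)$. - For $\beta \in \mathcal{A}$ let $N_\beta = \{\nu \in \mathbb{R}^{\mathcal{A}} : \nu_\alpha \ge 0 \text{ for all } \alpha\neq\beta,\ \sum_{\alpha}\nu_\alpha = 0\}$. A vector $\nu \in N_\beta$ is an $X$-circuit of $\mathcal{A}$ if it is nonzero,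 $\sigma_X(-\mathcal{A}\nu) < \infty$, and it cannot be written as $\theta\nu^{(1)} + (1-\theta)\nu^{(2)}$ with $0<\theta<1$ and linearly independent $\nu^{(1)},\nu^{(2)} \in N_\beta$ such that $\sigma_X(-\mathcal{A}(a\nu^{(1)}+b\nu^{(2)})) = a\,\sigma_X(-\mathcal{A}\nu^{(1)}) + b\,\sigma_X(-\mathcal{A}\nu^{(2)})$ for all $a,b\ge 0$ with $a+b=1$ (with $0\cdot\infty = 0$). It is normalized if in addition $\nu_\beta = -1$; $\Lambda_X(\mathcal{A})$ is the set of all normalized $X$-circuits, over all $\beta\in\mathcal{A}$. - The circuit graph $G_X(\mathcal{A}) \subset \mathbb{R}^{\mathcal{A}}\times\mathbb{R}$ is the convex cone (containing the origin) generated by the functional forms $\phi_\lambda = (\lambda, \sigma_X(-\mathcal{A}\lambda))$ for $\lambda\in\Lambda_X(\mathcal{A})$ together with the vector $(\mathbf{0},1)$. - $K^*=\{v : v^T u \ge 0 \text{ for all } u\in K\}$ denotes the dual cone, for the standard inner products on $\mathbb{R}^{\mathcal{A}}$ and on $\mathbb{R}^{\mathcal{A}}\times\mathbb{R}$, and $\exp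 y$ is taken entrywise. Then $$C_X(\mathcal{A})^* = \operatorname{cl}\{\exp y : y\in\mathbb{R}^{\mathcal{A}},\ (y,1)\in G_X(\mathcal{A})^*\}.$$ In particular, $C_X(\mathcal{A})^*$ is not only convex but also convex after a logarithmic change of coordinates (multiplicatively convex): the set $\{y\in\mathbb{R}^{\mathcal{A}} : \exp y \in C_X(\mathcal{A})^*\}$ is convex. -/

import Mathlib

open scoped Pointwise

noncomputable section

namespace XSage

variable {n : ℕ}

/-- The value at `x` of the signomial `∑ α, c α • e^α` supported on `A`, where
`e^α (x) = exp (αᵀ x)`. -/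
def signomial (A : Finset (EuclideanSpace ℝ (Fin n))) (c : A → ℝ)
    (x : EuclideanSpace ℝ (Fin n)) : ℝ :=
  ∑ α : A, c α * Real.exp (inner ℝ (α : EuclideanSpace ℝ (Fin n)) x)

/-- The cone `C_X(A, β)` of `X`-AGE signomials, a signomial supported on `A` being identified with
its coefficient vector in `ℝ^A`: the signomial is nonnegative on `X`, and every coefficient except
possibly the one at `β` is nonnegative. -/
def ageCone (X : Set (EuclideanSpace ℝ (Fin n))) (A : Finset (EuclideanSpace ℝ (Fin n)))
    (β : A) : Set (A → ℝ) :=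
  {c | (∀ x ∈ X, 0 ≤ signomial A c x) ∧ ∀ α, α ≠ β → 0 ≤ c α}

/-- The `X`-SAGE cone `C_X(A)`: the Minkowski sum of the `X`-AGE cones. -/
def sageCone (X : Set (EuclideanSpace ℝ (Fin n))) (A : Finset (EuclideanSpace ℝ (Fin n))) :
    Set (A → ℝ) :=
  ∑ β : A, ageCone X A β

/-- The support function `σ_X(y) = sup {yᵀ x : x ∈ X}`, with values in the extended reals. -/
def supportFun (X : Set (EuclideanSpace ℝ (Fin n))) (y : EuclideanSpace ℝ (Fin n)) : EReal :=
  ⨆ x ∈ X, ((inner ℝ y x : ℝ) : EReal)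

/-- `A` as a linear operator: `A ν = ∑ α, ν α • α`. -/
def applyExp (A : Finset (EuclideanSpace ℝ (Fin n))) (ν : A → ℝ) : EuclideanSpace ℝ (Fin n) :=
  ∑ α : A, ν α • (α : EuclideanSpace ℝ (Fin n))

/-- The augmented support function `ν ↦ σ_X(-A ν)`. -/
def augSupport (X : Set (EuclideanSpace ℝ (Fin n))) (A : Finset (EuclideanSpace ℝ (Fin n)))
    (ν : A → ℝ) : EReal :=
  supportFun X (-applyExp A ν)

/-- The cone `N_β` of vectors whose entries sum to zero and are nonnegative away from `β`. -/
def nCone (A : Finset (EuclideanSpace ℝ (Fin n))) (β : A) : Set (A → ℝ) :=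
  {ν | (∀ α, α ≠ β → 0 ≤ ν α) ∧ ∑ α, ν α = 0}

/-- `ν ↦ σ_X(-A ν)` is linear on the segment `[ν₁, ν₂]`. (If this holds and the function is finite
at some point strictly between `ν₁` and `ν₂`, then it is finite on the whole segment.) -/
def LinearOnSegment (X : Set (EuclideanSpace ℝ (Fin n)))
    (A : Finset (EuclideanSpace ℝ (Fin n))) (ν₁ ν₂ : A → ℝ) : Prop :=
  ∀ a b : ℝ, 0 ≤ a → 0 ≤ b → a + b = 1 →
    augSupport X A (a • ν₁ + b • ν₂) =
      (a : EReal) * augSupport X A ν₁ + (b : EReal) * augSupport X A ν₂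

/-- `ν ∈ N_β` is an `X`-circuit of `A`: it is nonzero, `σ_X(-A ν) < ∞`, and it is not a (proper)
convex combination of two non-proportional `ν₁, ν₂ ∈ N_β` such that `σ_X(-A ·)` is linear on
`[ν₁, ν₂]`. -/
def IsCircuitAt (X : Set (EuclideanSpace ℝ (Fin n))) (A : Finset (EuclideanSpace ℝ (Fin n)))
    (β : A) (ν : A → ℝ) : Prop :=
  ν ∈ nCone A β ∧ ν ≠ 0 ∧ augSupport X A ν < ⊤ ∧
    ¬ ∃ ν₁ ∈ nCone A β, ∃ ν₂ ∈ nCone A β,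
      LinearIndependent ℝ ![ν₁, ν₂] ∧ ν ∈ openSegment ℝ ν₁ ν₂ ∧ LinearOnSegment X A ν₁ ν₂

/-- The set `Λ_X(A)` of normalized `X`-circuits: those whose negative entry is `-1`. -/
def normalizedCircuits (X : Set (EuclideanSpace ℝ (Fin n)))
    (A : Finset (EuclideanSpace ℝ (Fin n))) : Set (A → ℝ) :=
  {l | ∃ β : A, IsCircuitAt X A β l ∧ l β = -1}

/-- The functional form `φ_ν = (ν, σ_X(-A ν)) ∈ ℝ^A × ℝ` of an `X`-circuit `ν` (for which
`σ_X(-A ν)` is finite). -/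
def functionalForm (X : Set (EuclideanSpace ℝ (Fin n)))
    (A : Finset (EuclideanSpace ℝ (Fin n))) (ν : A → ℝ) : (A → ℝ) × ℝ :=
  (ν, (augSupport X A ν).toReal)

/-- The circuit graph `G_X(A)`: the convex cone generated by the functional forms of the normalized
`X`-circuits together with `(0, 1)`. -/
def circuitGraph (X : Set (EuclideanSpace ℝ (Fin n)))
    (A : Finset (EuclideanSpace ℝ (Fin n))) : PointedCone ℝ ((A → ℝ) × ℝ) :=
  PointedCone.hull ℝ (functionalForm X A '' normalizedCircuits X A ∪ {((0 : A → ℝ), (1 : ℝ))})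

/-- The standard inner product on `ℝ^ι × ℝ`. -/
def prodPairing (ι : Type*) [Fintype ι] : ((ι → ℝ) × ℝ) →ₗ[ℝ] ((ι → ℝ) × ℝ) →ₗ[ℝ] ℝ :=
  (dotProductBilin ℝ ℝ).compl₁₂ (LinearMap.fst ℝ (ι → ℝ) ℝ) (LinearMap.fst ℝ (ι → ℝ) ℝ) +
    (LinearMap.mul ℝ ℝ).compl₁₂ (LinearMap.snd ℝ (ι → ℝ) ℝ) (LinearMap.snd ℝ (ι → ℝ) ℝ)

theorem prodPairing_apply {ι : Type*} [Fintype ι] (p q : (ι → ℝ) × ℝ) :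
    prodPairing ι p q = ∑ i, p.1 i * q.1 i + p.2 * q.2 := by
  simp [prodPairing, dotProductBilin, dotProduct]

/-- The dual SAGE cone `C_X(A)* = {v ∈ ℝ^A : vᵀ c ≥ 0 for all c ∈ C_X(A)}`. -/
def dualSageCone (X : Set (EuclideanSpace ℝ (Fin n)))
    (A : Finset (EuclideanSpace ℝ (Fin n))) : PointedCone ℝ (A → ℝ) :=
  PointedCone.dual (dotProductBilin ℝ ℝ) (sageCone X A)

/-- The dual `G_X(A)*` of the circuit graph, inside `ℝ^A × ℝ`. -/
def dualCircuitGraph (X : Set (EuclideanSpace ℝ (Fin n)))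
    (A : Finset (EuclideanSpace ℝ (Fin n))) : PointedCone ℝ ((A → ℝ) × ℝ) :=
  PointedCone.dual (prodPairing A) (circuitGraph X A : Set ((A → ℝ) × ℝ))

/-- The exponential function applied entrywise. -/
def expVec {ι : Type*} (y : ι → ℝ) : ι → ℝ := fun i => Real.exp (y i)

end XSage

end

/-!
The dual SAGE cone is the intersection of the duals of the AGE cones. It is closed, and since it
contains the positive vectors `exp (Aᵀ x)` for `x ∈ X`, its positive vectors are dense in it
(`mem_closure_positive_of_mem_dualSageCone`). Everything therefore reduces to the equivalence
`expVec_mem_dualSageCone_iff`: `exp y` is in the dual SAGE cone if and only if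
`lᵀ y + σ_X(-A l) ≥ 0` for every normalized circuit `l`.

If `exp y` is dual to the AGE cones, the inequality at `l` comes from pairing `exp y` with one AGE
signomial, which weighted AM-GM builds from `l` (`nonneg_of_forall_ageCone`).

Conversely, suppose the inequalities hold at the normalized circuits. The function
`g(ν) = νᵀ y + σ_X(-A ν)`, a lower semicontinuous convex function, is then nonnegative on each
`N_β`. Otherwise it has a negative minimum on the simplex `N_β ∩ {ν_β = -1}`. An extreme point of
the set of minimizers is a circuit, because linearity of `σ_X(-A ·)` on a segment through it makes
both normalized ends minimizers (`isCircuitAt_of_mem_extremePoints`), and `g` is negative there.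
Separation now places `y` in the closure of the vectors `y'` such that
`y'_α - y'_β ≥ (α - β)ᵀ x` for some `x ∈ X` and all `α` (`mem_closure_logAgeDual`). For such a `y'`
and an AGE vector `c`, the number `cᵀ exp y'` is at least a positive multiple of the value at `x` of
the signomial with coefficients `c`, hence nonnegative.
-/

namespace XSage

open Matrix

variable {n : ℕ} {X : Set (EuclideanSpace ℝ (Fin n))} {A : Finset (EuclideanSpace ℝ (Fin n))}

/-! ### The augmented support function through real inequalities -/

/-- The vector `(αᵀ x)_α` of exponents evaluated at `x`, that is, the transpose of `applyExp`. -/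
noncomputable def exponentVec (A : Finset (EuclideanSpace ℝ (Fin n)))
    (x : EuclideanSpace ℝ (Fin n)) : A → ℝ :=
  fun α => inner ℝ (α : EuclideanSpace ℝ (Fin n)) x

theorem inner_neg_applyExp (ν : A → ℝ) (x : EuclideanSpace ℝ (Fin n)) :
    inner ℝ (-applyExp A ν) x = -(ν ⬝ᵥ exponentVec A x) := by
  simp [applyExp, exponentVec, dotProduct, sum_inner, inner_smul_left]

theorem signomial_eq_dotProduct (c : A → ℝ) (x : EuclideanSpace ℝ (Fin n)) :
    signomial A c x = c ⬝ᵥ expVec (exponentVec A x) := rfl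

theorem augSupport_le_coe_iff {ν : A → ℝ} {r : ℝ} :
    augSupport X A ν ≤ (r : EReal) ↔ ∀ x ∈ X, -(ν ⬝ᵥ exponentVec A x) ≤ r := by
  simp only [augSupport, supportFun, iSup_le_iff, inner_neg_applyExp, EReal.coe_le_coe_iff]

theorem augSupport_ne_bot (hX : X.Nonempty) (ν : A → ℝ) : augSupport X A ν ≠ ⊥ := by
  obtain ⟨x, hx⟩ := hX
  intro h
  have := le_iSup₂_of_le (f := fun x (_ : x ∈ X) => ((inner ℝ (-applyExp A ν) x : ℝ) : EReal))
    x hx le_rfl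
  rw [show (⨆ x ∈ X, ((inner ℝ (-applyExp A ν) x : ℝ) : EReal)) = ⊥ from h] at this
  simp at this

theorem coe_toReal_augSupport (hX : X.Nonempty) {ν : A → ℝ} (h : augSupport X A ν ≠ ⊤) :
    (((augSupport X A ν).toReal : ℝ) : EReal) = augSupport X A ν :=
  EReal.coe_toReal h (augSupport_ne_bot hX ν)

/-- A linear perturbation of the augmented support function: `ν ↦ sup_{x ∈ X} νᵀ (y - Aᵀ x)`,
which is `νᵀ y + σ_X(-A ν)`. -/
noncomputable def gap (X : Set (EuclideanSpace ℝ (Fin n))) (A : Finset (EuclideanSpace ℝ (Fin n)))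
    (y ν : A → ℝ) : EReal :=
  ⨆ x ∈ X, ((ν ⬝ᵥ (y - exponentVec A x) : ℝ) : EReal)

theorem gap_le_coe_iff {y ν : A → ℝ} {r : ℝ} :
    gap X A y ν ≤ (r : EReal) ↔ ∀ x ∈ X, ν ⬝ᵥ (y - exponentVec A x) ≤ r := by
  simp only [gap, iSup_le_iff, EReal.coe_le_coe_iff]

theorem gap_le_coe_iff_augSupport_le {y ν : A → ℝ} {r : ℝ} :
    gap X A y ν ≤ (r : EReal) ↔ augSupport X A ν ≤ ((r - ν ⬝ᵥ y : ℝ) : EReal) := by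
  rw [gap_le_coe_iff, augSupport_le_coe_iff]
  refine forall₂_congr fun x _ => ?_
  rw [dotProduct_sub]
  constructor <;> intro h <;> linarith

theorem lowerSemicontinuous_gap (y : A → ℝ) : LowerSemicontinuous (gap X A y) := by
  refine lowerSemicontinuous_biSup fun x _ => Continuous.lowerSemicontinuous ?_
  refine continuous_coe_real_ereal.comp ?_
  fun_prop

theorem gap_ne_bot (hX : X.Nonempty) (y ν : A → ℝ) : gap X A y ν ≠ ⊥ := by
  obtain ⟨x, hx⟩ := hX
  intro h
  have := le_iSup₂_of_le (f := fun x (_ : x ∈ X) => ((ν ⬝ᵥ (y - exponentVec A x) : ℝ) : EReal))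
    x hx le_rfl
  rw [show (⨆ x ∈ X, ((ν ⬝ᵥ (y - exponentVec A x) : ℝ) : EReal)) = ⊥ from h, le_bot_iff] at this
  exact EReal.coe_ne_bot _ this

/-! ### The normalized slice of `N_β` -/

theorem neg_of_mem_nCone {β : A} {ν : A → ℝ} (hν : ν ∈ nCone A β) (h0 : ν ≠ 0) : ν β < 0 := by
  by_contra! h
  have hnn : ∀ α ∈ Finset.univ, 0 ≤ ν α := fun α _ => by
    by_cases hα : α = β
    · rwa [hα]
    · exact hν.1 α hα
  exact h0 (funext fun α => (Finset.sum_eq_zero_iff_of_nonneg hnn).1 hν.2 α (Finset.mem_univ α))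

theorem smul_mem_nCone {β : A} {ν : A → ℝ} (hν : ν ∈ nCone A β) {t : ℝ} (ht : 0 ≤ t) :
    t • ν ∈ nCone A β :=
  ⟨fun α hα => mul_nonneg ht (hν.1 α hα), by
    simp only [Pi.smul_apply, smul_eq_mul, ← Finset.mul_sum, hν.2, mul_zero]⟩

theorem isCompact_nCone_slice (β : A) : IsCompact (nCone A β ∩ {ν | ν β = -1}) := by
  refine (isCompact_Icc (a := (-1 : A → ℝ)) (b := 1)).of_isClosed_subset ?_ ?_
  · refine IsClosed.inter (IsClosed.inter ?_ ?_) (isClosed_eq (by fun_prop) (by fun_prop))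
    · change IsClosed {ν : A → ℝ | ∀ α, α ≠ β → 0 ≤ ν α}
      simp only [Set.ofPred_forall]
      exact isClosed_iInter fun α => isClosed_iInter fun _ =>
        isClosed_le (by fun_prop) (by fun_prop)
    · exact isClosed_eq (by fun_prop) (by fun_prop)
  · rintro ν ⟨⟨hnn, hsum⟩, hβ : ν β = -1⟩
    have hsum' : ∑ α ∈ Finset.univ.erase β, ν α = 1 := by
      have := Finset.add_sum_erase Finset.univ ν (Finset.mem_univ β)
      linarith
    refine ⟨fun α => ?_, fun α => ?_⟩ <;> by_cases hα : α = β
    · simp [hα, hβ]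
    · exact le_trans (by simp) (hnn α hα)
    · simp [hα, hβ]
    · refine le_of_le_of_eq ?_ hsum'
      exact Finset.single_le_sum (f := ν) (s := Finset.univ.erase β)
        (fun γ hγ => hnn γ (Finset.ne_of_mem_erase hγ))
        (Finset.mem_erase.2 ⟨hα, Finset.mem_univ α⟩)

theorem inv_smul_mem_nCone_slice {β : A} {ν : A → ℝ} (hν : ν ∈ nCone A β) (h : ν β < 0) :
    (-ν β)⁻¹ • ν ∈ nCone A β ∩ {ν | ν β = -1} := by
  refine ⟨smul_mem_nCone hν (inv_nonneg.2 (by linarith)), ?_⟩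
  change (-ν β)⁻¹ * ν β = -1
  rw [inv_neg, neg_mul, inv_mul_cancel₀ h.ne]

theorem gap_inv_smul_le {y ν : A → ℝ} {s t : ℝ} (ht : 0 < t) (hs : augSupport X A ν ≤ s) :
    gap X A y (t⁻¹ • ν) ≤ ((t⁻¹ * (s + ν ⬝ᵥ y) : ℝ) : EReal) := by
  rw [augSupport_le_coe_iff] at hs
  rw [gap_le_coe_iff]
  intro x hx
  rw [smul_dotProduct, dotProduct_sub, smul_eq_mul]
  have := hs x hx
  gcongr
  linarith

/-! ### Normalized circuits detect negativity -/

/-- If `σ_X(-A ·)` is linear on a segment and finite at an interior point of it, then it is finite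
at both ends, since the value `-∞` never occurs. -/
theorem LinearOnSegment.augSupport_ne_top (hX : X.Nonempty) {ν₁ ν₂ : A → ℝ}
    (h : LinearOnSegment X A ν₁ ν₂) {a b : ℝ} (ha : 0 < a) (hb : 0 < b) (hab : a + b = 1)
    (hfin : augSupport X A (a • ν₁ + b • ν₂) < ⊤) :
    augSupport X A ν₁ ≠ ⊤ ∧ augSupport X A ν₂ ≠ ⊤ := by
  have key := h a b ha.le hb.le hab
  have hbot : ∀ (t : ℝ) (_ : 0 < t) (ν : A → ℝ), (t : EReal) * augSupport X A ν ≠ ⊥ := by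
    intro t ht ν
    have hν := augSupport_ne_bot hX ν
    induction hs : augSupport X A ν with
    | bot => exact absurd hs hν
    | coe r => rw [← EReal.coe_mul]; exact EReal.coe_ne_bot _
    | top => rw [EReal.coe_mul_top_of_pos ht]; exact top_ne_bot
  constructor <;> intro htop
  · rw [htop, EReal.coe_mul_top_of_pos ha, EReal.top_add_of_ne_bot (hbot b hb ν₂)] at key
    exact hfin.ne key
  · rw [htop, EReal.coe_mul_top_of_pos hb, EReal.add_top_of_ne_bot (hbot a ha ν₁)] at key
    exact hfin.ne key

/-- An extreme point of the set of minimizers of `gap X A y` on the normalized slice of `N_β` is an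
`X`-circuit: linearity of `σ_X(-A ·)` on a segment through it forces the normalized ends of the
segment to be minimizers too. -/
theorem isCircuitAt_of_mem_extremePoints (hX : X.Nonempty) {β : A} {y : A → ℝ} {m : ℝ}
    (hm : ∀ ν ∈ nCone A β ∩ {ν | ν β = -1}, (m : EReal) ≤ gap X A y ν) {l : A → ℝ}
    (hl : l ∈ ((nCone A β ∩ {ν | ν β = -1}) ∩ {ν | gap X A y ν ≤ m}).extremePoints ℝ) :
    IsCircuitAt X A β l := by
  obtain ⟨⟨⟨hlN, hlβ : l β = -1⟩, hlm⟩, hext⟩ := hl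
  have hlm' := gap_le_coe_iff_augSupport_le.1 hlm
  have hfin : augSupport X A l < ⊤ := lt_of_le_of_lt hlm' (EReal.coe_lt_top _)
  refine ⟨hlN, ?_, hfin, ?_⟩
  · rintro rfl
    simp at hlβ
  rintro ⟨ν₁, h₁, ν₂, h₂, hind, ⟨a, b, ha, hb, hab, rfl⟩, hlin⟩
  obtain ⟨hf₁, hf₂⟩ := hlin.augSupport_ne_top hX ha hb hab hfin
  have hν₁ := neg_of_mem_nCone h₁ (by simpa using hind.ne_zero 0)
  have hν₂ := neg_of_mem_nCone h₂ (by simpa using hind.ne_zero 1)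
  have key := hlin a b ha.le hb.le hab
  obtain ⟨s₁, hs₁⟩ : ∃ s : ℝ, (s : EReal) = augSupport X A ν₁ := ⟨_, coe_toReal_augSupport hX hf₁⟩
  obtain ⟨s₂, hs₂⟩ : ∃ s : ℝ, (s : EReal) = augSupport X A ν₂ := ⟨_, coe_toReal_augSupport hX hf₂⟩
  rw [key, ← hs₁, ← hs₂, ← EReal.coe_mul, ← EReal.coe_mul, ← EReal.coe_add,
    EReal.coe_le_coe_iff, add_dotProduct, smul_dotProduct, smul_dotProduct, smul_eq_mul,
    smul_eq_mul] at hlm'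
  have hnorm : a * ν₁ β + b * ν₂ β = -1 := by simpa using hlβ
  set t₁ := -ν₁ β with ht₁
  set t₂ := -ν₂ β with ht₂
  have ht₁0 : 0 < t₁ := by linarith
  have ht₂0 : 0 < t₂ := by linarith
  have hμ₁ := inv_smul_mem_nCone_slice h₁ hν₁
  have hμ₂ := inv_smul_mem_nCone_slice h₂ hν₂
  have hg₁ := gap_inv_smul_le (y := y) ht₁0 hs₁.ge
  have hg₂ := gap_inv_smul_le (y := y) ht₂0 hs₂.ge
  have hm₁ := EReal.coe_le_coe_iff.1 ((hm _ hμ₁).trans hg₁)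
  have hm₂ := EReal.coe_le_coe_iff.1 ((hm _ hμ₂).trans hg₂)
  rw [le_inv_mul_iff₀ ht₁0] at hm₁
  rw [le_inv_mul_iff₀ ht₂0] at hm₂
  have hsum : a * t₁ + b * t₂ = 1 := by rw [ht₁, ht₂]; linarith
  have hm₁a := mul_le_mul_of_nonneg_left hm₁ ha.le
  have hm₂b := mul_le_mul_of_nonneg_left hm₂ hb.le
  have hmsum : m = a * (t₁ * m) + b * (t₂ * m) := by
    linear_combination (-m) * hsum
  -- both ends attain the minimum
  have e₁ : s₁ + ν₁ ⬝ᵥ y ≤ t₁ * m := by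
    refine le_of_mul_le_mul_left ?_ ha
    linarith
  have e₂ : s₂ + ν₂ ⬝ᵥ y ≤ t₂ * m := by
    refine le_of_mul_le_mul_left ?_ hb
    linarith
  have hM₁ : gap X A y (t₁⁻¹ • ν₁) ≤ m :=
    hg₁.trans (EReal.coe_le_coe_iff.2 ((inv_mul_le_iff₀ ht₁0).2 e₁))
  have hM₂ : gap X A y (t₂⁻¹ • ν₂) ≤ m :=
    hg₂.trans (EReal.coe_le_coe_iff.2 ((inv_mul_le_iff₀ ht₂0).2 e₂))
  have hseg : a • ν₁ + b • ν₂ ∈ openSegment ℝ (t₁⁻¹ • ν₁) (t₂⁻¹ • ν₂) := by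
    refine ⟨a * t₁, b * t₂, by positivity, by positivity, hsum, ?_⟩
    rw [smul_smul, smul_smul, mul_assoc, mul_assoc, mul_inv_cancel₀ ht₁0.ne',
      mul_inv_cancel₀ ht₂0.ne', mul_one, mul_one]
  have heq₁ := hext ⟨hμ₁, hM₁⟩ ⟨hμ₂, hM₂⟩ hseg
  have heq₂ := hext ⟨hμ₂, hM₂⟩ ⟨hμ₁, hM₁⟩ (by rwa [openSegment_symm])
  have := (LinearIndependent.pair_iff.1 hind) t₁⁻¹ (-t₂⁻¹) (by rw [neg_smul, heq₁, heq₂]; abel)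
  exact (inv_pos.2 ht₁0).ne' this.1

/-- If `νᵀ y + σ_X(-A ν)` is negative somewhere on some `N_β`, then it is negative at a normalized
`X`-circuit. -/
theorem exists_normalizedCircuit_augSupport_lt (hX : X.Nonempty) {β : A} {y ν : A → ℝ}
    (hν : ν ∈ nCone A β) (h : augSupport X A ν < ((-(ν ⬝ᵥ y) : ℝ) : EReal)) :
    ∃ l ∈ normalizedCircuits X A, augSupport X A l < ((-(l ⬝ᵥ y) : ℝ) : EReal) := by
  set S : Set (A → ℝ) := nCone A β ∩ {ν | ν β = -1}
  obtain ⟨s, hs⟩ : ∃ s : ℝ, (s : EReal) = augSupport X A ν :=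
    ⟨_, coe_toReal_augSupport hX (h.trans (EReal.coe_lt_top _)).ne⟩
  have hsy : s < -(ν ⬝ᵥ y) := by rwa [← hs, EReal.coe_lt_coe_iff] at h
  have hsup := augSupport_le_coe_iff.1 hs.ge
  have hν0 : ν ≠ 0 := by
    rintro rfl
    obtain ⟨x, hx⟩ := hX
    have := hsup x hx
    simp only [zero_dotProduct] at this hsy
    linarith
  have ht := neg_of_mem_nCone hν hν0
  have hμS := inv_smul_mem_nCone_slice hν ht
  have hμgap := gap_inv_smul_le (y := y) (neg_pos.2 ht) hs.ge
  have hneg : (-ν β)⁻¹ * (s + ν ⬝ᵥ y) < 0 :=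
    mul_neg_of_pos_of_neg (inv_pos.2 (by linarith)) (by linarith)
  obtain ⟨l₀, hl₀S, hl₀⟩ := LowerSemicontinuousOn.exists_isMinOn ⟨_, hμS⟩ (isCompact_nCone_slice β)
    ((lowerSemicontinuous_gap (X := X) y).lowerSemicontinuousOn S)
  have hl₀le : gap X A y l₀ ≤ (((-ν β)⁻¹ * (s + ν ⬝ᵥ y) : ℝ) : EReal) := (hl₀ hμS).trans hμgap
  obtain ⟨m, hm⟩ : ∃ m : ℝ, (m : EReal) = gap X A y l₀ :=
    ⟨_, EReal.coe_toReal (hl₀le.trans_lt (EReal.coe_lt_top _)).ne (gap_ne_bot hX y l₀)⟩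
  have hm0 : m < 0 := by
    rw [← hm, EReal.coe_le_coe_iff] at hl₀le
    linarith
  have hcomp : IsCompact (S ∩ {ν | gap X A y ν ≤ m}) :=
    (isCompact_nCone_slice β).inter_right ((lowerSemicontinuous_gap y).isClosed_preimage _)
  obtain ⟨l, hl⟩ := hcomp.extremePoints_nonempty ⟨l₀, hl₀S, hm.ge⟩
  refine ⟨l, ⟨β, isCircuitAt_of_mem_extremePoints hX (fun ν hν => hm ▸ hl₀ hν) hl, hl.1.1.2⟩, ?_⟩
  refine (gap_le_coe_iff_augSupport_le.1 hl.1.2).trans_lt (EReal.coe_lt_coe_iff.2 ?_)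
  linarith

/-! ### Separation and the AGE cones -/

/-- The vectors `y` for which `y_α - y_β ≥ (α - β)ᵀ x` for some `x ∈ X` and all `α`; these are the
logarithms of the positive vectors lying above a multiple of some `exp (Aᵀ x)`, with equality
at `β`. -/
noncomputable def logAgeDual (X : Set (EuclideanSpace ℝ (Fin n))) (A : Finset (EuclideanSpace ℝ (Fin n)))
    (β : A) : Set (A → ℝ) :=
  {y | ∃ x ∈ X, ∀ α, exponentVec A x α - exponentVec A x β ≤ y α - y β}

theorem convex_logAgeDual (hX : Convex ℝ X) (β : A) : Convex ℝ (logAgeDual X A β) := by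
  rintro y₁ ⟨x₁, hx₁, h₁⟩ y₂ ⟨x₂, hx₂, h₂⟩ a b ha hb hab
  refine ⟨a • x₁ + b • x₂, hX hx₁ hx₂ ha hb hab, fun α => ?_⟩
  have e₁ := mul_le_mul_of_nonneg_left (h₁ α) ha
  have e₂ := mul_le_mul_of_nonneg_left (h₂ α) hb
  simp only [exponentVec, inner_add_right, inner_smul_right, Pi.add_apply, Pi.smul_apply,
    smul_eq_mul] at e₁ e₂ ⊢
  linarith

/-- If `νᵀ y + σ_X(-A ν) ≥ 0` on all of `N_β`, then `y` is in the closure of `logAgeDual X A β`: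
a functional separating `y` from that set would be an element of `N_β` violating the hypothesis. -/
theorem mem_closure_logAgeDual (hXc : Convex ℝ X) (hX : X.Nonempty) {β : A} {y : A → ℝ}
    (h : ∀ ν ∈ nCone A β, ((-(ν ⬝ᵥ y) : ℝ) : EReal) ≤ augSupport X A ν) :
    y ∈ closure (logAgeDual X A β) := by
  by_contra hy
  obtain ⟨φ, u, hφy, hφ⟩ := geometric_hahn_banach_point_closed
    (convex_logAgeDual hXc β).closure isClosed_closure hy
  set ν : A → ℝ := fun α => φ (Pi.single α 1) with hνdef
  have hφν : ∀ z, φ z = ν ⬝ᵥ z := by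
    intro z
    conv_lhs => rw [pi_eq_sum_univ' z]
    simp [dotProduct, hνdef, mul_comm]
  -- the set contains `Aᵀ x + t 1 + w` for `x ∈ X`, all `t`, and all `w ≥ 0` vanishing at `β`
  have hmem : ∀ x ∈ X, ∀ (t : ℝ) (w : A → ℝ), 0 ≤ w → w β = 0 →
      u < ν ⬝ᵥ exponentVec A x + t * ∑ γ, ν γ + ν ⬝ᵥ w := by
    intro x hx t w hw hwβ
    have := hφ (exponentVec A x + t • (1 : A → ℝ) + w) (subset_closure ⟨x, hx, fun γ => ?_⟩)
    · rwa [hφν, dotProduct_add, dotProduct_add, dotProduct_smul, dotProduct_one,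
        smul_eq_mul] at this
    · have := hw γ
      simp only [Pi.add_apply, Pi.smul_apply, smul_eq_mul, Pi.one_apply, hwβ, Pi.zero_apply]
        at this ⊢
      linarith
  have hbase : ∀ x ∈ X, u < ν ⬝ᵥ exponentVec A x := fun x hx => by
    simpa using hmem x hx 0 0 le_rfl rfl
  obtain ⟨x₀, hx₀⟩ := hX
  have hνN : ν ∈ nCone A β := by
    refine ⟨fun α hα => ?_, ?_⟩
    · by_contra! hneg
      have hs : 0 ≤ (u - ν ⬝ᵥ exponentVec A x₀) / ν α :=
        div_nonneg_of_nonpos (by linarith [hbase x₀ hx₀]) hneg.le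
      have := hmem x₀ hx₀ 0 (Pi.single α ((u - ν ⬝ᵥ exponentVec A x₀) / ν α))
        (Pi.single_nonneg.2 hs) (Pi.single_eq_of_ne (Ne.symm hα) _)
      rw [dotProduct_single, mul_div_cancel₀ _ hneg.ne] at this
      linarith
    · by_contra hne
      have := hmem x₀ hx₀ ((u - ν ⬝ᵥ exponentVec A x₀) / ∑ γ, ν γ) 0 le_rfl rfl
      rw [div_mul_cancel₀ _ hne, dotProduct_zero] at this
      linarith
  have hle : augSupport X A ν ≤ ((-u : ℝ) : EReal) :=
    augSupport_le_coe_iff.2 fun x hx => by linarith [hbase x hx]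
  have := EReal.coe_le_coe_iff.1 ((h ν hνN).trans hle)
  rw [hφν] at hφy
  linarith

theorem continuous_dotProduct_expVec (c : A → ℝ) : Continuous fun y => c ⬝ᵥ expVec y := by
  unfold expVec
  fun_prop

theorem dotProduct_expVec_nonneg_of_mem_closure {β : A} {c y : A → ℝ} (hc : c ∈ ageCone X A β)
    (hy : y ∈ closure (logAgeDual X A β)) : 0 ≤ c ⬝ᵥ expVec y := by
  refine closure_minimal (t := {y | 0 ≤ c ⬝ᵥ expVec y}) ?_
    (isClosed_le continuous_const (continuous_dotProduct_expVec c)) hy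
  rintro z ⟨x, hx, hz⟩
  have hsig := hc.1 x hx
  rw [signomial_eq_dotProduct] at hsig
  calc (0 : ℝ) ≤ Real.exp (z β - exponentVec A x β) * (c ⬝ᵥ expVec (exponentVec A x)) := by
        positivity
    _ = ∑ α, c α * Real.exp (z β - exponentVec A x β + exponentVec A x α) := by
        simp only [dotProduct, Finset.mul_sum, expVec, Real.exp_add]
        exact Finset.sum_congr rfl fun α _ => by ring
    _ ≤ c ⬝ᵥ expVec z := by
        refine Finset.sum_le_sum fun α _ => ?_
        by_cases hα : α = β
        · subst hα
          simp [expVec]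
        · refine mul_le_mul_of_nonneg_left (Real.exp_le_exp.2 ?_) (hc.2 α hα)
          linarith [hz α]

/-- Weighted AM-GM: for `ν` in the normalized slice of `N_β` with `σ_X(-A ν) ≤ s`, the vector with
entries `(ν_α + [α = β]) exp (-y_α) - [α = β] exp (-y_β - νᵀ y - s)` lies in `C_X(A, β)`. Its
product with `exp y` is `1 - exp (-νᵀ y - s)`, so this product being nonnegative
means `νᵀ y + s ≥ 0`. -/
theorem nonneg_of_forall_ageCone {β : A} {ν y : A → ℝ} {s : ℝ} (hν : ν ∈ nCone A β)
    (hβ : ν β = -1) (hs : augSupport X A ν ≤ s)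
    (h : ∀ c ∈ ageCone X A β, 0 ≤ c ⬝ᵥ expVec y) : 0 ≤ ν ⬝ᵥ y + s := by
  rw [augSupport_le_coe_iff] at hs
  set w : A → ℝ := ν + Pi.single β 1 with hw
  have hw0 : ∀ α, 0 ≤ w α := fun α => by
    by_cases hα : α = β
    · simp [hw, hα, hβ]
    · simpa [hw, hα] using hν.1 α hα
  have hw1 : ∑ α, w α = 1 := by
    simp only [hw, Pi.add_apply, Finset.sum_add_distrib, hν.2, zero_add]
    simp
  set e : ℝ := Real.exp (-y β - ν ⬝ᵥ y - s) with he
  have hc : (w * fun α => Real.exp (-y α)) - Pi.single β e ∈ ageCone X A β := by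
    refine ⟨fun x hx => ?_, fun α hα => ?_⟩
    · rw [signomial_eq_dotProduct, sub_dotProduct, single_dotProduct, sub_nonneg]
      have hamgm := convexOn_exp.map_sum_le (t := Finset.univ) (w := w)
        (p := exponentVec A x - y) (fun α _ => hw0 α) hw1 (fun _ _ => Set.mem_univ _)
      have hsum : ∑ α, w α • (exponentVec A x - y) α
          = ν ⬝ᵥ exponentVec A x - ν ⬝ᵥ y + (exponentVec A x β - y β) := by
        change w ⬝ᵥ (exponentVec A x - y) = _
        rw [hw, add_dotProduct, dotProduct_sub, single_dotProduct]
        simp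
      rw [hsum] at hamgm
      calc e * expVec (exponentVec A x) β
          = Real.exp (-y β - ν ⬝ᵥ y - s + exponentVec A x β) := by rw [Real.exp_add]; rfl
        _ ≤ _ := Real.exp_le_exp.2 (by linarith [hs x hx])
        _ ≤ _ := hamgm
        _ = _ := Finset.sum_congr rfl fun α _ => by
          simp only [Pi.sub_apply, Pi.mul_apply, smul_eq_mul, expVec, mul_assoc, ← Real.exp_add]
          ring_nf
    · have := mul_nonneg (hw0 α) (Real.exp_pos (-y α)).le
      simpa [hα] using this
  have hpos := h _ hc
  have hone : (w * fun α => Real.exp (-y α)) ⬝ᵥ expVec y = 1 := by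
    rw [← hw1]
    refine Finset.sum_congr rfl fun α _ => ?_
    simp only [Pi.mul_apply, expVec, mul_assoc, ← Real.exp_add]
    simp
  have hexp : e * expVec y β = Real.exp (-(ν ⬝ᵥ y + s)) := by
    rw [he, expVec, ← Real.exp_add]
    ring_nf
  rw [sub_dotProduct, single_dotProduct, hone, hexp, sub_nonneg, Real.exp_le_one_iff] at hpos
  linarith

/-! ### The dual cones -/

theorem ageCone_subset_sageCone (β : A) : ageCone X A β ⊆ sageCone X A := by
  intro c hc
  have hzero : ∀ γ, (0 : A → ℝ) ∈ ageCone X A γ := fun γ =>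
    ⟨fun x _ => by simp [signomial], fun _ _ => le_rfl⟩
  rw [sageCone, Set.mem_fintype_sum]
  refine ⟨Pi.single β c, fun γ => ?_, by simp⟩
  by_cases h : γ = β
  · subst h
    simpa using hc
  · simpa [h] using hzero γ

theorem mem_dualSageCone_iff {v : A → ℝ} :
    v ∈ dualSageCone X A ↔ ∀ β, ∀ c ∈ ageCone X A β, 0 ≤ c ⬝ᵥ v := by
  rw [dualSageCone, PointedCone.mem_dual]
  refine ⟨fun h β c hc => h (ageCone_subset_sageCone β hc), fun h c hc => ?_⟩
  rw [sageCone, Set.mem_fintype_sum] at hc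
  obtain ⟨g, hg, rfl⟩ := hc
  change 0 ≤ (∑ β, g β) ⬝ᵥ v
  rw [sum_dotProduct]
  exact Finset.sum_nonneg fun β _ => h β _ (hg β)

theorem mk_one_mem_dualCircuitGraph_iff {y : A → ℝ} :
    (y, (1 : ℝ)) ∈ dualCircuitGraph X A ↔
      ∀ l ∈ normalizedCircuits X A, 0 ≤ l ⬝ᵥ y + (augSupport X A l).toReal := by
  rw [dualCircuitGraph, circuitGraph, PointedCone.dual_hull, PointedCone.mem_dual]
  constructor
  · intro h l hl
    simpa [prodPairing_apply, functionalForm, dotProduct] using h (Or.inl ⟨l, hl, rfl⟩)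
  · rintro h _ (⟨l, hl, rfl⟩ | rfl)
    · simpa [prodPairing_apply, functionalForm, dotProduct] using h l hl
    · simp [prodPairing_apply]

/-- In logarithmic coordinates, the positive part of the dual SAGE cone is cut out by the linear
inequalities coming from the normalized circuits. -/
theorem expVec_mem_dualSageCone_iff (hXc : Convex ℝ X) (hX : X.Nonempty) {y : A → ℝ} :
    expVec y ∈ dualSageCone X A ↔ (y, (1 : ℝ)) ∈ dualCircuitGraph X A := by
  rw [mem_dualSageCone_iff, mk_one_mem_dualCircuitGraph_iff]
  constructor
  · rintro h l ⟨β, hl, hlβ⟩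
    exact nonneg_of_forall_ageCone hl.1 hlβ (coe_toReal_augSupport hX hl.2.2.1.ne).ge (h β)
  · intro h β c hc
    refine dotProduct_expVec_nonneg_of_mem_closure hc
      (mem_closure_logAgeDual hXc hX fun ν hν => ?_)
    by_contra! hlt
    obtain ⟨l, hl, hl'⟩ := exists_normalizedCircuit_augSupport_lt hX hν hlt
    have hly := h l hl
    rw [← coe_toReal_augSupport hX (hl'.trans (EReal.coe_lt_top _)).ne,
      EReal.coe_lt_coe_iff] at hl'
    linarith

theorem nonneg_of_mem_dualSageCone {v : A → ℝ} (hv : v ∈ dualSageCone X A) (α : A) : 0 ≤ v α := by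
  have := mem_dualSageCone_iff.1 hv α (Pi.single α 1) ⟨fun x _ => ?_, fun γ hγ => ?_⟩
  · simpa using this
  · rw [signomial_eq_dotProduct, single_dotProduct, one_mul]
    exact (Real.exp_pos _).le
  · simp [hγ]

theorem isClosed_dualSageCone : IsClosed (dualSageCone X A : Set (A → ℝ)) := by
  have : (dualSageCone X A : Set (A → ℝ)) = ⋂ c ∈ sageCone X A, {v | 0 ≤ c ⬝ᵥ v} := by
    ext v
    simp only [Set.mem_iInter]
    rfl
  rw [this]
  exact isClosed_biInter fun c _ => isClosed_le (by fun_prop) (by fun_prop)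

theorem expVec_exponentVec_mem_dualSageCone {x : EuclideanSpace ℝ (Fin n)} (hx : x ∈ X) :
    expVec (exponentVec A x) ∈ dualSageCone X A :=
  mem_dualSageCone_iff.2 fun _ c hc => signomial_eq_dotProduct c x ▸ hc.1 x hx

/-- Positive vectors are dense in the dual SAGE cone, because `v + t exp (Aᵀ x)` belongs to it for
`x ∈ X` and `t > 0`. -/
theorem mem_closure_positive_of_mem_dualSageCone (hX : X.Nonempty) {v : A → ℝ}
    (hv : v ∈ dualSageCone X A) :
    v ∈ closure (expVec '' {y | expVec y ∈ dualSageCone X A}) := by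
  obtain ⟨x, hx⟩ := hX
  have hlim : Filter.Tendsto (fun t : ℝ => v + t • expVec (exponentVec A x))
      (nhdsWithin 0 (Set.Ioi 0)) (nhds v) := by
    have : Continuous fun t : ℝ => v + t • expVec (exponentVec A x) := by fun_prop
    simpa using (this.tendsto 0).mono_left nhdsWithin_le_nhds
  refine mem_closure_of_tendsto hlim (eventually_mem_nhdsWithin.mono fun t (ht : 0 < t) => ?_)
  have hmem : v + t • expVec (exponentVec A x) ∈ dualSageCone X A :=
    add_mem hv ((dualSageCone X A).smul_mem ht.le
      (expVec_exponentVec_mem_dualSageCone hx))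
  have hexp : expVec (fun α => Real.log ((v + t • expVec (exponentVec A x)) α))
      = v + t • expVec (exponentVec A x) := by
    funext α
    refine Real.exp_log ?_
    exact add_pos_of_nonneg_of_pos (nonneg_of_mem_dualSageCone hv α)
      (mul_pos ht (Real.exp_pos _))
  exact ⟨_, by rwa [Set.mem_ofPred_eq, hexp], hexp⟩

end XSage

theorem theorem5p2 {n : ℕ} (X : Set (EuclideanSpace ℝ (Fin n)))
    (A : Finset (EuclideanSpace ℝ (Fin n)))
    (hXclosed : IsClosed X) (hXconvex : Convex ℝ X) (hXne : X.Nonempty) (hA : A.Nonempty) :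
    (XSage.dualSageCone X A : Set (A → ℝ)) =
        closure (XSage.expVec '' {y : A → ℝ | (y, (1 : ℝ)) ∈ XSage.dualCircuitGraph X A}) ∧
      Convex ℝ (XSage.dualSageCone X A : Set (A → ℝ)) ∧
      Convex ℝ {y : A → ℝ | XSage.expVec y ∈ XSage.dualSageCone X A} := by
  simp only [← XSage.expVec_mem_dualSageCone_iff hXconvex hXne]
  refine ⟨Set.Subset.antisymm
    (fun v hv => XSage.mem_closure_positive_of_mem_dualSageCone hXne hv)
    (closure_minimal (Set.image_subset_iff.2 fun y hy => hy) XSage.isClosed_dualSageCone),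
    PointedCone.convex _, ?_⟩
  simp only [XSage.expVec_mem_dualSageCone_iff hXconvex hXne]
  intro y₁ h₁ y₂ h₂ a b ha hb hab
  have := (PointedCone.convex (XSage.dualCircuitGraph X A)) h₁ h₂ ha hb hab
  simpa [hab] using this
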